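/- Consider submodular load balancing (SLB): given monotone non-decreasing, normalized ($f_i(\emptyset)=0$), submodular functions $f_1,\dots,f_m:2^V\to\mathbb{R}$ on a ground set $V$ with $|V|=n$, find an ordered partition $\pi=(A_1,\dots,A_m)$ of $V$ into $m$ pairwise disjoint, possibly empty blocks that minimizes $\max_i f_i(A_i)$; write $\mathrm{OPT}$ for the minimum. The instance is homogeneous if $f_1=\dots=f_m$. Algorithms access the functions only through value queries, each of which returns $f_i(S)$ for a chosen index $i$ and a chosen set $S\subseteq V$; queries may be adaptive, and computation between queries is unrestricted. **Theorem.** Let $\epsilon>0$ and let $m=m(n)\ge 1$ be integers with $m=o(\sqrt{n/\log n})$ as $n\to\infty$. Then SLB cannot be approximated within a factor $(1-\epsilon)m$ with a polynomial number of value queries, even in the homogeneous case. Precisely: 1. For every family of deterministic algorithms (one for each $n$) whose number of queries on homogeneous instances is at most a polynomial in $n$, for all sufficiently large $n$ there is a homogeneous instance with $|V|=n$ on which the algorithm outputs a partition $(A_1,\dots,A_m)$ with $\max_i f_i(A_i)>(1-\epsilon)\,m\cdot\mathrm{OPT}$. 2. For every family of randomized algorithms (one for each $n$) whose number of queries on each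 homogeneous instance is almost surely at most a polynomial in $n$, and for every $\delta>0$, for all sufficiently large $n$ there is a homogeneous instance with $|V|=n$ on which the algorithm outputs a partition $(A_1,\dots,A_m)$ with $\max_i f_i(A_i)\le(1-\epsilon)\,m\cdot\mathrm{OPT}$ with probability at most $\delta$. -/

import Mathlib

open Filter Asymptotics MeasureTheory

universe u

namespace SLB

/-- Monotone non-decreasing, normalized, submodular real-valued set functions on the ground set
`V = Fin n`. -/
structure IsMonotoneSubmodular {n : ℕ} (f : Finset (Fin n) → ℝ) : Prop where
  normalized : f ∅ = 0
  monotone : ∀ S T : Finset (Fin n), S ⊆ T → f S ≤ f T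
  submodular : ∀ S T : Finset (Fin n), f (S ∪ T) + f (S ∩ T) ≤ f S + f T

/-- An ordered partition of `V = Fin n` into `m` (possibly empty) blocks. -/
structure OrderedPartition (n m : ℕ) where
  block : Fin m → Finset (Fin n)
  disjoint : ∀ i j : Fin m, i ≠ j → block i ∩ block j = ∅
  cover : Finset.univ.biUnion block = Finset.univ

/-- `f 0, …, f (m - 1)` is an instance of submodular load balancing. -/
def IsInstance {n m : ℕ} (f : Fin m → Finset (Fin n) → ℝ) : Prop :=
  ∀ i, IsMonotoneSubmodular (f i)

/-- The homogeneous case: all the functions are identical. -/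
def IsHomogeneous {n m : ℕ} (f : Fin m → Finset (Fin n) → ℝ) : Prop :=
  ∀ i j, f i = f j

/-- The min-max objective of a partition: `max_i f_i(A_i)`. -/
noncomputable def cost {n m : ℕ} (f : Fin m → Finset (Fin n) → ℝ) (π : OrderedPartition n m) : ℝ :=
  ⨆ i, f i (π.block i)

/-- The optimal value: the minimum over all ordered partitions of `max_i f_i(A_i)`. -/
noncomputable def opt {n m : ℕ} (f : Fin m → Finset (Fin n) → ℝ) : ℝ :=
  ⨅ π : OrderedPartition n m, cost f π

/-- The partition `π` solves the instance `f` within the factor `ρ`. -/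
def IsApprox {n m : ℕ} (ρ : ℝ) (f : Fin m → Finset (Fin n) → ℝ) (π : OrderedPartition n m) : Prop :=
  cost f π ≤ ρ * opt f

/-- A deterministic adaptive algorithm in the value oracle model, for `n` items and `m` blocks: it
either stops and outputs an ordered partition, or asks for the value `f_i(S)` and continues in a way
that may depend arbitrarily on the answer (and on all earlier ones). Only oracle queries are
counted; computation between queries is free. -/
inductive QueryAlgorithm (n m : ℕ) : Type where
  | output (π : OrderedPartition n m) : QueryAlgorithm n m
  | query (i : Fin m) (S : Finset (Fin n)) (next : ℝ → QueryAlgorithm n m) : QueryAlgorithm n m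

/-- The partition that the algorithm outputs when its queries are answered by `f`. -/
def QueryAlgorithm.run {n m : ℕ} (f : Fin m → Finset (Fin n) → ℝ) :
    QueryAlgorithm n m → OrderedPartition n m
  | .output π => π
  | .query i S next => (next (f i S)).run f

/-- The number of queries that the algorithm makes when its queries are answered by `f`. -/
def QueryAlgorithm.numQueries {n m : ℕ} (f : Fin m → Finset (Fin n) → ℝ) :
    QueryAlgorithm n m → ℕ
  | .output _ => 0
  | .query i S next => (next (f i S)).numQueries f + 1

/-- A randomized algorithm in the value oracle model: a random seed, drawn from some probability
space, selects a deterministic algorithm. On each instance the output is a random variable. -/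
structure RandomizedQueryAlgorithm (n m : ℕ) where
  Seed : Type u
  [measurableSpace : MeasurableSpace Seed]
  prob : Measure Seed
  isProbabilityMeasure : IsProbabilityMeasure prob
  algorithm : Seed → QueryAlgorithm n m
  measurableSet_run_eq : ∀ f : Fin m → Finset (Fin n) → ℝ, IsInstance f →
    ∀ π : OrderedPartition n m, MeasurableSet {ω | (algorithm ω).run f = π}

/-- The probability that the randomized algorithm solves the instance `f` within the factor `ρ`. -/
noncomputable def RandomizedQueryAlgorithm.successProb {n m : ℕ}
    (R : RandomizedQueryAlgorithm.{u} n m) (ρ : ℝ) (f : Fin m → Finset (Fin n) → ℝ) : ℝ :=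
  R.prob.real {ω | IsApprox ρ f ((R.algorithm ω).run f)}

/-- A family of deterministic algorithms (one for each `n`) makes polynomially many queries on
homogeneous instances. -/
def PolynomialQueries {m : ℕ → ℕ} (A : ∀ n, QueryAlgorithm n (m n)) : Prop :=
  ∃ p : Polynomial ℕ, ∀ n, ∀ f : Fin (m n) → Finset (Fin n) → ℝ,
    IsInstance f → IsHomogeneous f → (A n).numQueries f ≤ p.eval n

/-- A family of randomized algorithms (one for each `n`) almost surely makes polynomially many
queries on homogeneous instances. -/
def RandomizedPolynomialQueries {m : ℕ → ℕ}
    (R : ∀ n, RandomizedQueryAlgorithm.{u} n (m n)) : Prop :=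
  ∃ p : Polynomial ℕ, ∀ n, ∀ f : Fin (m n) → Finset (Fin n) → ℝ,
    IsInstance f → IsHomogeneous f →
      ∀ᵐ ω ∂(R n).prob, ((R n).algorithm ω).numQueries f ≤ p.eval n

end SLB

/-!
The lower bound hides a random partition. Let `a = ⌈n / m⌉` and colour the ground set uniformly at
random with `m` colours, independently for each element. The functions

* `f₀ S = min(a, |S|)` (`cappedCard`) and
* `f_c S = min(a, ∑ j, min((1 + ε) a / m, |S ∩ V_j|))` (`hiddenPartition`), where `V_j` is the set
  of elements of colour `j`,

are monotone, normalized and submodular. Under `f₀` every partition costs `a`, because one of its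
blocks has at least `a` elements, whereas under `f_c` the partition into colour classes costs at
most `(1 + ε) a / m`. A partition of cost `a` is then not approximate within `(1 - ε) m`, since
`(1 - ε)(1 + ε) < 1`.

The values of `f₀` and `f_c` at a fixed set `S` differ only if a fixed subset of `S` with
`min(a, |S|)` elements contains more than `(1 + ε) a / m` elements of some colour. By Chernoff's
bound the fraction of colourings for which this happens is at most `m * exp(-κ a / m)` with a
constant `κ > 0` (`card_hiddenPartition_ne_le`). An algorithm whose queries on `f₀` do not
distinguish `f₀` from `f_c` outputs the same partition on both, and if the two functions also agree
on a largest block of this partition, the algorithm fails on `f_c`. A union bound over the queries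
and this block bounds the fraction of colourings with success
(`QueryAlgorithm.card_isApprox_le`); for randomized algorithms this is averaged over the seed.
The bound tends to zero for polynomially many queries, because `a / m ≥ n / m ^ 2` outgrows `log n`
(`tendsto_successBound`).
-/

namespace SLB

/-! ### Submodular set functions -/

section SetFunctions

variable {n : ℕ}

/-- Capping preserves submodularity; this uses monotonicity as well. -/
theorem IsMonotoneSubmodular.const_min {f : Finset (Fin n) → ℝ} (hf : IsMonotoneSubmodular f)
    {a : ℝ} (ha : 0 ≤ a) : IsMonotoneSubmodular fun S => min a (f S) where
  normalized := by simp [hf.normalized, ha]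
  monotone S T h := min_le_min_left a (hf.monotone S T h)
  submodular S T := by
    have h := hf.submodular S T
    have h₁ := hf.monotone _ _ (Finset.inter_subset_left : S ∩ T ⊆ S)
    have h₂ := hf.monotone _ _ (Finset.inter_subset_right : S ∩ T ⊆ T)
    have h₃ := hf.monotone _ _ (Finset.subset_union_left : S ⊆ S ∪ T)
    have h₄ := hf.monotone _ _ (Finset.subset_union_right : T ⊆ S ∪ T)
    rcases le_total a (f S) with hS | hS <;> rcases le_total a (f T) with hT | hT
    · rw [min_eq_left hS, min_eq_left hT]
      exact add_le_add (min_le_left _ _) (min_le_left _ _)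
    · rw [min_eq_left hS, min_eq_right hT]
      exact add_le_add (min_le_left _ _) ((min_le_right _ _).trans h₂)
    · rw [min_eq_right hS, min_eq_left hT, add_comm]
      exact add_le_add ((min_le_right _ _).trans h₁) (min_le_left _ _)
    · rw [min_eq_right hS, min_eq_right hT]
      exact (add_le_add (min_le_right _ _) (min_le_right _ _)).trans h

theorem IsMonotoneSubmodular.sum {ι : Type*} (s : Finset ι) {f : ι → Finset (Fin n) → ℝ}
    (hf : ∀ i ∈ s, IsMonotoneSubmodular (f i)) :
    IsMonotoneSubmodular fun S => ∑ i ∈ s, f i S where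
  normalized := Finset.sum_eq_zero fun i hi => (hf i hi).normalized
  monotone S T h := Finset.sum_le_sum fun i hi => (hf i hi).monotone S T h
  submodular S T := by
    simp only [← Finset.sum_add_distrib]
    exact Finset.sum_le_sum fun i hi => (hf i hi).submodular S T

theorem isMonotoneSubmodular_card_filter (p : Fin n → Prop) [DecidablePred p] :
    IsMonotoneSubmodular fun S => ((S.filter p).card : ℝ) where
  normalized := by simp
  monotone S T h := by exact_mod_cast Finset.card_le_card (Finset.filter_subset_filter p h)
  submodular S T := by
    rw [Finset.filter_union, Finset.filter_inter_distrib]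
    exact_mod_cast (Finset.card_union_add_card_inter _ _).le

end SetFunctions

/-! ### The hard instances -/

section Instances

variable {n m : ℕ}

/-- The rank-like function `S ↦ min(a, |S|)`, which carries no information on any partition. -/
noncomputable def cappedCard (n a : ℕ) (S : Finset (Fin n)) : ℝ :=
  min (a : ℝ) S.card

/-- The function `S ↦ min(a, ∑ j, min(β, |S ∩ V_j|))`, where `V_j` is the `j`-th colour class of the
colouring `c`. Every colour class has value at most `β`. -/
noncomputable def hiddenPartition (a : ℕ) (β : ℝ) (c : Fin n → Fin m) (S : Finset (Fin n)) : ℝ :=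
  min (a : ℝ) (∑ j, min β ((S.filter (c · = j)).card : ℝ))

theorem isMonotoneSubmodular_cappedCard (n a : ℕ) :
    IsMonotoneSubmodular (cappedCard n a) := by
  have h := (isMonotoneSubmodular_card_filter fun _ : Fin n => True).const_min a.cast_nonneg
  simp only [Finset.filter_true] at h
  exact h

theorem isMonotoneSubmodular_hiddenPartition (a : ℕ) {β : ℝ} (hβ : 0 ≤ β) (c : Fin n → Fin m) :
    IsMonotoneSubmodular (hiddenPartition a β c) :=
  (IsMonotoneSubmodular.sum _ fun j _ =>
    (isMonotoneSubmodular_card_filter (c · = j)).const_min hβ).const_min a.cast_nonneg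

theorem sum_card_colour (c : Fin n → Fin m) (S : Finset (Fin n)) :
    ∑ j, ((S.filter (c · = j)).card : ℝ) = S.card := by
  exact_mod_cast (Finset.card_eq_sum_card_fiberwise (f := c) (t := Finset.univ)
    fun _ _ => Finset.mem_coe.2 (Finset.mem_univ _)).symm

theorem hiddenPartition_le_cappedCard (a : ℕ) (β : ℝ) (c : Fin n → Fin m) (S : Finset (Fin n)) :
    hiddenPartition a β c S ≤ cappedCard n a S := by
  refine min_le_min_left _ ?_
  rw [← sum_card_colour c S]
  exact Finset.sum_le_sum fun j _ => min_le_right _ _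

/-- The two functions agree at `S` once some witness `T ⊆ S` with `min(a, |S|)` elements meets every
colour class in at most `β` elements. -/
theorem hiddenPartition_eq_cappedCard {a : ℕ} {β : ℝ} (hβ : 0 ≤ β) {c : Fin n → Fin m}
    {S T : Finset (Fin n)} (hTS : T ⊆ S) (hT : T.card = min a S.card)
    (h : ∀ j, ((T.filter (c · = j)).card : ℝ) ≤ β) :
    hiddenPartition a β c S = cappedCard n a S := by
  refine le_antisymm (hiddenPartition_le_cappedCard a β c S) ?_
  refine le_trans (le_of_eq ?_) ((isMonotoneSubmodular_hiddenPartition a hβ c).monotone T S hTS)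
  unfold hiddenPartition cappedCard
  rw [Finset.sum_congr rfl fun j _ => min_eq_right (h j), sum_card_colour, hT]
  push_cast
  simp

/-- The partition into colour classes. -/
def colourPartition (c : Fin n → Fin m) : OrderedPartition n m where
  block j := Finset.univ.filter (c · = j)
  disjoint i j hij := by
    ext v
    simp only [Finset.mem_inter, Finset.mem_filter, Finset.mem_univ, true_and, Finset.notMem_empty,
      iff_false, not_and]
    rintro rfl
    exact hij
  cover := by ext v; simp

theorem cost_nonneg {f : Fin m → Finset (Fin n) → ℝ} (hf : IsInstance f)
    (π : OrderedPartition n m) : 0 ≤ cost f π :=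
  Real.iSup_nonneg fun i => by
    simpa [(hf i).normalized] using (hf i).monotone ∅ (π.block i) (Finset.empty_subset _)

theorem opt_nonneg {f : Fin m → Finset (Fin n) → ℝ} (hf : IsInstance f) : 0 ≤ opt f :=
  Real.iInf_nonneg fun π => cost_nonneg hf π

theorem opt_le_cost {f : Fin m → Finset (Fin n) → ℝ} (hf : IsInstance f)
    (π : OrderedPartition n m) : opt f ≤ cost f π :=
  ciInf_le ⟨0, Set.forall_mem_range.2 fun π => cost_nonneg hf π⟩ π

theorem le_cost (f : Fin m → Finset (Fin n) → ℝ) (π : OrderedPartition n m) (i : Fin m) :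
    f i (π.block i) ≤ cost f π :=
  le_ciSup (f := fun i => f i (π.block i)) (Set.finite_range _).bddAbove i

theorem opt_hiddenPartition_le (a : ℕ) {β : ℝ} (hβ : 0 ≤ β) (c : Fin n → Fin m) :
    opt (fun _ : Fin m => hiddenPartition a β c) ≤ β := by
  refine (opt_le_cost (fun _ => isMonotoneSubmodular_hiddenPartition a hβ c)
    (colourPartition c)).trans (Real.iSup_le (fun i => (min_le_right _ _).trans ?_) hβ)
  rw [Finset.sum_eq_single i]
  · exact min_le_left _ _
  · intro j _ hj
    have : ((colourPartition c).block i).filter (c · = j) = ∅ := by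
      rw [Finset.filter_eq_empty_iff]
      intro v hv hvj
      exact hj (hvj.symm.trans (Finset.mem_filter.1 hv).2)
    simp [this, hβ]
  · simp

theorem OrderedPartition.exists_card_block_ge (π : OrderedPartition n m) (hm : 0 < m) :
    ∃ i, ⌈(n : ℝ) / m⌉₊ ≤ (π.block i).card := by
  by_contra! h
  have hm' : (0 : ℝ) < m := by exact_mod_cast hm
  have h₁ : (n : ℝ) ≤ ∑ i, ((π.block i).card : ℝ) := by
    have := Finset.card_biUnion_le (s := Finset.univ) (t := π.block)
    rw [π.cover, Finset.card_univ, Fintype.card_fin] at this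
    exact_mod_cast this
  have h₂ : ∑ i, ((π.block i).card : ℝ) < ∑ _i : Fin m, (n : ℝ) / m :=
    Finset.sum_lt_sum_of_nonempty ⟨⟨0, hm⟩, Finset.mem_univ _⟩ fun i _ => Nat.lt_ceil.1 (h i)
  rw [Finset.sum_const, Finset.card_univ, Fintype.card_fin, nsmul_eq_mul,
    mul_div_cancel₀ _ hm'.ne'] at h₂
  exact absurd h₁ h₂.not_ge

/-- Only finitely many partitions exist, so events about the output are finite unions of events of
the form `run = π`. -/
instance : Finite (OrderedPartition n m) :=
  Finite.of_injective OrderedPartition.block fun π π' h => by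
    cases π; cases π'; congr

end Instances

/-! ### Concentration of random colourings -/

section Counting

variable {n m : ℕ}

/-- The moment generating function of the number of elements of `S` of colour `j`, summed over all
colourings: the sum factorizes over the elements. -/
theorem sum_exp_card_colour_le (hm : 0 < m) (S : Finset (Fin n)) (j : Fin m) (t : ℝ) :
    ∑ c : Fin n → Fin m, Real.exp (t * (S.filter (c · = j)).card) ≤
      m ^ n * Real.exp (S.card * ((Real.exp t - 1) / m)) := by
  have hm' : (0 : ℝ) < m := by exact_mod_cast hm
  have h₁ : ∀ c : Fin n → Fin m, Real.exp (t * (S.filter (c · = j)).card) =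
      ∏ v, if v ∈ S ∧ c v = j then Real.exp t else 1 := by
    intro c
    rw [← Finset.prod_filter, Finset.prod_const, ← Real.exp_nat_mul, mul_comm]
    congr 4
    ext v
    simp
  have h₂ : ∀ v : Fin n, ∑ k : Fin m, (if v ∈ S ∧ k = j then Real.exp t else 1) =
      m * if v ∈ S then 1 + (Real.exp t - 1) / m else 1 := by
    intro v
    by_cases hv : v ∈ S
    · have : ∀ k : Fin m, (if v ∈ S ∧ k = j then Real.exp t else 1) =
          1 + if k = j then Real.exp t - 1 else 0 := by
        intro k
        by_cases hk : k = j <;> simp [hv, hk]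
      simp only [this, Finset.sum_add_distrib]
      simp [hv]
      field_simp
    · simp [hv]
  simp only [h₁]
  rw [← Fintype.piFinset_univ, ← Finset.prod_univ_sum (fun _ => Finset.univ)
    (fun v k => if v ∈ S ∧ k = j then Real.exp t else 1)]
  simp only [h₂, Finset.prod_mul_distrib, Finset.prod_const, Finset.card_univ, Fintype.card_fin,
    Finset.prod_ite_mem, Finset.univ_inter]
  rw [Real.exp_nat_mul]
  gcongr
  · have : -1 ≤ (Real.exp t - 1) / m := by
      rw [le_div_iff₀ hm']
      have : (1 : ℝ) ≤ m := by exact_mod_cast hm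
      linarith [Real.exp_pos t]
    linarith
  · linarith [Real.add_one_le_exp ((Real.exp t - 1) / m)]

/-- The exponent in the Chernoff bound for exceeding the mean by a factor `1 + ε`. -/
noncomputable def chernoffExponent (ε : ℝ) : ℝ :=
  (1 + ε) * Real.log (1 + ε) - ε

theorem chernoffExponent_pos {ε : ℝ} (hε : 0 < ε) : 0 < chernoffExponent ε := by
  have h : (0 : ℝ) < 1 + ε := by linarith
  have h₁ := Real.log_lt_sub_one_of_pos (inv_pos.2 h) (by
    rw [Ne, inv_eq_one]
    linarith)
  rw [Real.log_inv] at h₁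
  have h₂ : (1 + ε) * (1 - (1 + ε)⁻¹) = ε := by field_simp; ring
  have h₃ := mul_lt_mul_of_pos_left (show 1 - (1 + ε)⁻¹ < Real.log (1 + ε) by linarith) h
  unfold chernoffExponent
  linarith

/-- Chernoff's bound for a uniformly random colouring and a set of at most `a` elements, for which
the expected number of elements of a given colour is at most `a / m`. -/
theorem card_colour_gt_le {ε : ℝ} (hε : 0 < ε) (hm : 0 < m) {a : ℕ} {T : Finset (Fin n)}
    (hT : T.card ≤ a) (j : Fin m) :
    ((Finset.univ.filter fun c : Fin n → Fin m =>
      (1 + ε) * (a / m) < ((T.filter (c · = j)).card : ℝ)).card : ℝ) ≤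
      m ^ n * Real.exp (-(chernoffExponent ε * (a / m))) := by
  have hm' : (0 : ℝ) < m := by exact_mod_cast hm
  have h1 : (0 : ℝ) < 1 + ε := by linarith
  have ht : 0 < Real.log (1 + ε) := Real.log_pos (by linarith)
  -- The exponent `log (1 + ε)` is the one that optimizes Markov's inequality below.
  set t := Real.log (1 + ε)
  have het : Real.exp t = 1 + ε := Real.exp_log h1
  set B := Finset.univ.filter fun c : Fin n → Fin m =>
      (1 + ε) * (a / m) < ((T.filter (c · = j)).card : ℝ)
  have hmarkov : (B.card : ℝ) * Real.exp (t * ((1 + ε) * (a / m))) ≤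
      m ^ n * Real.exp (ε * (a / m)) := by
    calc (B.card : ℝ) * Real.exp (t * ((1 + ε) * (a / m)))
        = ∑ _c ∈ B, Real.exp (t * ((1 + ε) * (a / m))) := by
          rw [Finset.sum_const, nsmul_eq_mul]
      _ ≤ ∑ c ∈ B, Real.exp (t * (T.filter (c · = j)).card) := by
          refine Finset.sum_le_sum fun c hc => ?_
          have := (Finset.mem_filter.1 hc).2
          gcongr
      _ ≤ ∑ c : Fin n → Fin m, Real.exp (t * (T.filter (c · = j)).card) :=
          Finset.sum_le_sum_of_subset_of_nonneg (Finset.subset_univ _)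
            fun _ _ _ => (Real.exp_pos _).le
      _ ≤ m ^ n * Real.exp (T.card * ((Real.exp t - 1) / m)) := sum_exp_card_colour_le hm T j t
      _ ≤ m ^ n * Real.exp (ε * (a / m)) := by
          rw [het, add_sub_cancel_left]
          have : (T.card : ℝ) ≤ a := by exact_mod_cast hT
          have h : (T.card : ℝ) * (ε / m) ≤ a * (ε / m) := by gcongr
          have h' : (a : ℝ) * (ε / m) = ε * (a / m) := by ring
          rw [← h']
          gcongr
  have hexp : Real.exp (-(chernoffExponent ε * (a / m))) =
      Real.exp (ε * (a / m)) / Real.exp (t * ((1 + ε) * (a / m))) := by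
    rw [← Real.exp_sub]
    congr 1
    unfold chernoffExponent
    ring
  rw [hexp, ← mul_div_assoc, le_div_iff₀ (Real.exp_pos _)]
  exact hmarkov

theorem card_hiddenPartition_ne_le {ε : ℝ} (hε : 0 < ε) (hm : 0 < m) (a : ℕ)
    (S : Finset (Fin n)) :
    ((Finset.univ.filter fun c : Fin n → Fin m =>
      hiddenPartition a ((1 + ε) * (a / m)) c S ≠ cappedCard n a S).card : ℝ) ≤
      m * (m ^ n * Real.exp (-(chernoffExponent ε * (a / m)))) := by
  obtain ⟨T, hTS, hT⟩ := Finset.exists_subset_card_eq (min_le_right a S.card)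
  have hsub : (Finset.univ.filter fun c : Fin n → Fin m =>
      hiddenPartition a ((1 + ε) * (a / m)) c S ≠ cappedCard n a S) ⊆
      Finset.univ.biUnion fun j : Fin m => Finset.univ.filter fun c : Fin n → Fin m =>
        (1 + ε) * (a / m) < ((T.filter (c · = j)).card : ℝ) := by
    intro c hc
    by_contra h
    simp only [Finset.mem_biUnion, Finset.mem_filter, Finset.mem_univ, true_and, not_exists,
      not_lt] at h
    exact (Finset.mem_filter.1 hc).2 (hiddenPartition_eq_cappedCard (by positivity) hTS hT h)
  calc _ ≤ ∑ j : Fin m, ((Finset.univ.filter fun c : Fin n → Fin m =>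
        (1 + ε) * (a / m) < ((T.filter (c · = j)).card : ℝ)).card : ℝ) := by
        exact_mod_cast (Finset.card_le_card hsub).trans Finset.card_biUnion_le
    _ ≤ ∑ _j : Fin m, (m ^ n * Real.exp (-(chernoffExponent ε * (a / m))) : ℝ) :=
        Finset.sum_le_sum fun j _ =>
          card_colour_gt_le hε hm (hT.le.trans (min_le_left _ _)) j
    _ = _ := by simp

end Counting

/-! ### Indistinguishability for query algorithms -/

section Algorithms

variable {n m : ℕ}

/-- The sets whose values the algorithm asks for when its queries are answered by `f`. -/
def QueryAlgorithm.queriedSets (f : Fin m → Finset (Fin n) → ℝ) :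
    QueryAlgorithm n m → List (Finset (Fin n))
  | .output _ => []
  | .query i S next => S :: (next (f i S)).queriedSets f

theorem QueryAlgorithm.length_queriedSets (f : Fin m → Finset (Fin n) → ℝ)
    (A : QueryAlgorithm n m) : (A.queriedSets f).length = A.numQueries f := by
  induction A with
  | output π => rfl
  | query i S next ih => simp [queriedSets, numQueries, ih]

/-- An algorithm cannot distinguish two instances that agree on the queries that it makes on one of
them. -/
theorem QueryAlgorithm.run_congr {f g : Fin m → Finset (Fin n) → ℝ} (A : QueryAlgorithm n m)
    (h : ∀ S ∈ A.queriedSets f, ∀ i, g i S = f i S) : A.run g = A.run f := by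
  induction A with
  | output π => rfl
  | query i S next ih =>
    simp only [queriedSets, List.mem_cons, forall_eq_or_imp] at h
    simp only [run, h.1 i]
    exact ih _ h.2

/-- The capacity `⌈n / m⌉`: every partition has a block of at least that size. -/
noncomputable def capacity (n m : ℕ) : ℕ := ⌈(n : ℝ) / m⌉₊

/-- The homogeneous instance with the partition into the colour classes of `c` hidden in it. The
colour classes get the cap `(1 + ε) * capacity n m / m`, a factor `1 + ε` above the expected number
of elements of one colour in a set of `capacity n m` elements. -/
noncomputable def hardInstance (ε : ℝ) (c : Fin n → Fin m) : Fin m → Finset (Fin n) → ℝ :=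
  fun _ => hiddenPartition (capacity n m) ((1 + ε) * (capacity n m / m)) c

theorem isInstance_hardInstance {ε : ℝ} (hε : 0 < ε) (c : Fin n → Fin m) :
    IsInstance (hardInstance ε c) :=
  fun _ => isMonotoneSubmodular_hiddenPartition _ (by positivity) c

theorem isHomogeneous_hardInstance (ε : ℝ) (c : Fin n → Fin m) :
    IsHomogeneous (hardInstance ε c) :=
  fun _ _ => rfl

theorem capacity_pos (hn : 0 < n) (hm : 0 < m) : 0 < capacity n m :=
  Nat.ceil_pos.2 (by positivity)

/-- A partition with a block whose cost is the whole capacity is not `(1 - ε) m`-approximate. -/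
theorem not_isApprox_hardInstance {ε : ℝ} (hε : 0 < ε) (hn : 0 < n) (hm : 0 < m)
    {c : Fin n → Fin m} {π : OrderedPartition n m} {i : Fin m}
    (hi : capacity n m ≤ (π.block i).card)
    (h : hiddenPartition (capacity n m) ((1 + ε) * (capacity n m / m)) c (π.block i) =
      cappedCard n (capacity n m) (π.block i)) :
    ¬ IsApprox ((1 - ε) * m) (hardInstance ε c) π := by
  have hm' : (0 : ℝ) < m := by exact_mod_cast hm
  have ha : (0 : ℝ) < capacity n m := by exact_mod_cast capacity_pos hn hm
  have hcost : (capacity n m : ℝ) ≤ cost (hardInstance ε c) π := by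
    refine le_trans (le_of_eq ?_) (le_cost _ _ i)
    rw [hardInstance, h, cappedCard, min_eq_left (by exact_mod_cast hi)]
  have hopt : opt (hardInstance ε c) ≤ (1 + ε) * (capacity n m / m) :=
    opt_hiddenPartition_le _ (by positivity) c
  have hopt₀ := opt_nonneg (isInstance_hardInstance hε c)
  rw [IsApprox, not_le]
  refine lt_of_lt_of_le ?_ hcost
  rcases le_total ε 1 with h1 | h1
  · calc (1 - ε) * m * opt (hardInstance ε c)
        ≤ (1 - ε) * m * ((1 + ε) * (capacity n m / m)) := by
          refine mul_le_mul_of_nonneg_left hopt (mul_nonneg (by linarith) hm'.le)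
      _ = (1 - ε ^ 2) * capacity n m := by field_simp; ring
      _ < 1 * capacity n m := by
          refine mul_lt_mul_of_pos_right ?_ ha
          nlinarith
      _ = capacity n m := one_mul _
  -- The factor `(1 - ε) m` is not positive here.
  · refine lt_of_le_of_lt ?_ ha
    exact mul_nonpos_of_nonpos_of_nonneg
      (mul_nonpos_of_nonpos_of_nonneg (by linarith) hm'.le) hopt₀

/-- An upper bound for the fraction of colourings on which an algorithm with at most `q` queries
succeeds. -/
noncomputable def successBound (ε : ℝ) (n m q : ℕ) : ℝ :=
  (q + 1) * (m * Real.exp (-(chernoffExponent ε * (capacity n m / m))))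

open Classical in
/-- On success the algorithm has noticed the difference between the hard instance and the capped
cardinality, on one of the queries that it makes on the latter or on a largest block of the
partition that it outputs on the latter. These sets do not depend on the colouring. -/
theorem QueryAlgorithm.card_isApprox_le {ε : ℝ} (hε : 0 < ε) (hn : 0 < n) (hm : 0 < m)
    (A : QueryAlgorithm n m) {q : ℕ}
    (hq : A.numQueries (fun _ => cappedCard n (capacity n m)) ≤ q) :
    ((Finset.univ.filter fun c : Fin n → Fin m =>
      IsApprox ((1 - ε) * m) (hardInstance ε c) (A.run (hardInstance ε c))).card : ℝ) ≤
      successBound ε n m q * m ^ n := by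
  set f₀ : Fin m → Finset (Fin n) → ℝ := fun _ => cappedCard n (capacity n m)
  obtain ⟨i, hi⟩ := (A.run f₀).exists_card_block_ge hm
  set L := ((A.run f₀).block i :: A.queriedSets f₀).toFinset
  have hL : L.card ≤ q + 1 := by
    refine (List.toFinset_card_le _).trans ?_
    rw [List.length_cons, A.length_queriedSets]
    omega
  have hsub : (Finset.univ.filter fun c : Fin n → Fin m =>
      IsApprox ((1 - ε) * m) (hardInstance ε c) (A.run (hardInstance ε c))) ⊆
      L.biUnion fun S => Finset.univ.filter fun c : Fin n → Fin m =>
        hiddenPartition (capacity n m) ((1 + ε) * (capacity n m / m)) c S ≠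
          cappedCard n (capacity n m) S := by
    intro c hc
    by_contra h
    simp only [Finset.mem_biUnion, Finset.mem_filter, Finset.mem_univ, true_and, not_exists,
      not_and, not_not] at h
    have hrun : A.run (hardInstance ε c) = A.run f₀ :=
      A.run_congr fun S hS _ => h S (List.mem_toFinset.2 (List.mem_cons_of_mem _ hS))
    have hc' := (Finset.mem_filter.1 hc).2
    rw [hrun] at hc'
    exact not_isApprox_hardInstance hε hn hm hi
      (h _ (List.mem_toFinset.2 List.mem_cons_self)) hc'
  set b : ℝ := m * (m ^ n * Real.exp (-(chernoffExponent ε * (capacity n m / m))))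
  calc _ ≤ ∑ S ∈ L, ((Finset.univ.filter fun c : Fin n → Fin m =>
        hiddenPartition (capacity n m) ((1 + ε) * (capacity n m / m)) c S ≠
          cappedCard n (capacity n m) S).card : ℝ) := by
        exact_mod_cast (Finset.card_le_card hsub).trans Finset.card_biUnion_le
    _ ≤ ∑ _S ∈ L, b := Finset.sum_le_sum fun S _ => by
        convert card_hiddenPartition_ne_le hε hm (capacity n m) S
    _ = L.card * b := by rw [Finset.sum_const, nsmul_eq_mul]
    _ ≤ ((q + 1 : ℕ) : ℝ) * b := by
        have : (L.card : ℝ) ≤ (q + 1 : ℕ) := by exact_mod_cast hL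
        gcongr
    _ = successBound ε n m q * m ^ n := by
        simp only [b, successBound]
        push_cast
        ring

theorem QueryAlgorithm.exists_not_isApprox {ε : ℝ} (hε : 0 < ε) (hn : 0 < n) (hm : 0 < m)
    (A : QueryAlgorithm n m) {q : ℕ}
    (hq : A.numQueries (fun _ => cappedCard n (capacity n m)) ≤ q)
    (hlt : successBound ε n m q < 1) :
    ∃ c : Fin n → Fin m,
      ¬ IsApprox ((1 - ε) * m) (hardInstance ε c) (A.run (hardInstance ε c)) := by
  classical
  by_contra! h
  have hm' : (0 : ℝ) < m := by exact_mod_cast hm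
  have h₁ := A.card_isApprox_le hε hn hm hq
  rw [Finset.filter_true_of_mem fun c _ => h c, Finset.card_univ, Fintype.card_fun,
    Fintype.card_fin, Fintype.card_fin] at h₁
  push_cast at h₁
  have h₂ : successBound ε n m q * (m : ℝ) ^ n < 1 * (m : ℝ) ^ n :=
    mul_lt_mul_of_pos_right hlt (by positivity)
  linarith

/-- Averaging over the colourings turns the bound for each seed into a bound for the success
probability on some hard instance. -/
theorem RandomizedQueryAlgorithm.exists_successProb_le {ε : ℝ} (hε : 0 < ε) (hn : 0 < n)
    (hm : 0 < m) (R : RandomizedQueryAlgorithm.{u} n m) {q : ℕ}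
    (hq : ∀ᵐ ω ∂(R.prob),
      (R.algorithm ω).numQueries (fun _ => cappedCard n (capacity n m)) ≤ q) :
    ∃ c : Fin n → Fin m,
      R.successProb ((1 - ε) * m) (hardInstance ε c) ≤ successBound ε n m q := by
  classical
  let _ := R.measurableSpace
  have := R.isProbabilityMeasure
  set E : (Fin n → Fin m) → Set R.Seed := fun c =>
    {ω | IsApprox ((1 - ε) * m) (hardInstance ε c) ((R.algorithm ω).run (hardInstance ε c))}
  have hE : ∀ c, MeasurableSet (E c) := by
    intro c
    have : E c = ⋃ π ∈ {π | IsApprox ((1 - ε) * m) (hardInstance ε c) π},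
        {ω | (R.algorithm ω).run (hardInstance ε c) = π} := by
      ext ω
      simp [E]
    rw [this]
    exact (Set.toFinite _).measurableSet_biUnion fun π _ =>
      R.measurableSet_run_eq _ (isInstance_hardInstance hε c) π
  have hint : ∀ c, Integrable ((E c).indicator fun _ => (1 : ℝ)) R.prob := fun c =>
    (integrable_const 1).indicator (hE c)
  have hsum : ∑ c, R.prob.real (E c) ≤ successBound ε n m q * m ^ n := by
    calc ∑ c, R.prob.real (E c)
        = ∑ c, ∫ ω, (E c).indicator (fun _ => (1 : ℝ)) ω ∂(R.prob) := by
          refine Finset.sum_congr rfl fun c _ => ?_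
          rw [integral_indicator_const _ (hE c), smul_eq_mul, mul_one]
      _ = ∫ ω, ∑ c, (E c).indicator (fun _ => (1 : ℝ)) ω ∂(R.prob) :=
          (integral_finsetSum _ fun c _ => hint c).symm
      _ ≤ ∫ _ω, successBound ε n m q * (m : ℝ) ^ n ∂(R.prob) := by
          refine integral_mono_ae (integrable_finsetSum _ fun c _ => hint c)
            (integrable_const _) ?_
          filter_upwards [hq] with ω hω
          refine le_trans (le_of_eq ?_) ((R.algorithm ω).card_isApprox_le hε hn hm hω)
          simp [Set.indicator_apply, E]
      _ = _ := by simp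
  by_contra! h
  have hcard : ((Finset.univ : Finset (Fin n → Fin m)).card : ℝ) = m ^ n := by simp
  have : Nonempty (Fin n → Fin m) := ⟨fun _ => ⟨0, hm⟩⟩
  have hlt := Finset.sum_lt_sum_of_nonempty Finset.univ_nonempty
    fun (c : Fin n → Fin m) _ => h c
  rw [Finset.sum_const, nsmul_eq_mul, hcard, mul_comm] at hlt
  exact absurd hsum hlt.not_ge

end Algorithms

/-! ### The bound for polynomially many queries -/

section Asymptotics

/-- Since `n / m ^ 2` outgrows every multiple of `log n`, the exponential factor beats every
polynomial. -/
theorem tendsto_successBound {ε : ℝ} (hε : 0 < ε) {m : ℕ → ℕ} (hm : ∀ n, 1 ≤ m n)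
    (hmo : (fun n : ℕ => (m n : ℝ)) =o[atTop] (fun n : ℕ => Real.sqrt ((n : ℝ) / Real.log n)))
    (p : Polynomial ℕ) :
    Tendsto (fun n => successBound ε n (m n) (p.eval n)) atTop (nhds 0) := by
  set κ := chernoffExponent ε
  have hκ : 0 < κ := chernoffExponent_pos hε
  set P : Polynomial ℝ := (p.map (Nat.castRingHom ℝ) + 1) * Polynomial.X
  set d := P.natDegree + 1
  have hd : (0 : ℝ) < d := by positivity
  have hlim : Tendsto (fun n : ℕ => P.eval (n : ℝ) / (Polynomial.X ^ d : Polynomial ℝ).eval (n : ℝ))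
      atTop (nhds 0) := by
    refine (Polynomial.div_tendsto_atTop_zero_of_degree_lt P (Polynomial.X ^ d) ?_).comp
      tendsto_natCast_atTop_atTop
    rw [Polynomial.degree_X_pow]
    exact Polynomial.degree_le_natDegree.trans_lt (by exact_mod_cast Nat.lt_succ_self _)
  -- The constant `κ / d` is chosen so that `κ * n / m ^ 2 ≥ d * log n`; the minimum with `1`
  -- gives `m ≤ n`.
  have hbound := hmo.bound (c := Real.sqrt (min 1 (κ / d))) (by positivity)
  refine squeeze_zero' (Eventually.of_forall fun n => ?_) ?_ hlim
  · unfold successBound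
    positivity
  filter_upwards [hbound, eventually_ge_atTop 3] with n hn hn3
  have hm' : (0 : ℝ) < m n := by exact_mod_cast hm n
  have hm1 : (1 : ℝ) ≤ m n := by exact_mod_cast hm n
  have hn' : (0 : ℝ) < n := by positivity
  have hlog : 1 ≤ Real.log n := by
    rw [Real.le_log_iff_exp_le hn']
    have : (3 : ℝ) ≤ n := by exact_mod_cast hn3
    linarith [Real.exp_one_lt_d9]
  have hsq : (m n : ℝ) ^ 2 ≤ min 1 (κ / d) * (n / Real.log n) := by
    rw [Real.norm_of_nonneg hm'.le, Real.norm_of_nonneg (Real.sqrt_nonneg _),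
      ← Real.sqrt_mul (by positivity)] at hn
    exact (Real.le_sqrt' hm').1 hn
  have hmn : (m n : ℝ) ≤ n := by
    calc (m n : ℝ) ≤ m n ^ 2 := by nlinarith
      _ ≤ min 1 (κ / d) * (n / Real.log n) := hsq
      _ ≤ 1 * (n / 1) := by gcongr; exact min_le_left _ _
      _ = n := by ring
  have hexp : d * Real.log n ≤ κ * (capacity n (m n) / m n) := by
    have h₁ : (m n : ℝ) ^ 2 ≤ κ / d * (n / Real.log n) :=
      hsq.trans (by gcongr; exact min_le_right _ _)
    have h₂ : d * Real.log n * (m n : ℝ) ^ 2 ≤ κ * n := by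
      calc d * Real.log n * (m n : ℝ) ^ 2 ≤ d * Real.log n * (κ / d * (n / Real.log n)) := by
            gcongr
        _ = κ * n := by field_simp
    calc d * Real.log n ≤ κ * n / (m n : ℝ) ^ 2 := by rwa [le_div_iff₀ (by positivity)]
      _ = κ * (n / m n / m n) := by field_simp
      _ ≤ κ * (capacity n (m n) / m n) := by
          gcongr
          exact Nat.le_ceil _
  have hPeval : P.eval (n : ℝ) = ((p.eval n : ℕ) + 1 : ℝ) * n := by
    simp [P, Polynomial.eval_natCast_map]
  calc successBound ε n (m n) (p.eval n)
      ≤ ((p.eval n : ℕ) + 1) * (n * Real.exp (-(d * Real.log n))) := by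
        unfold successBound
        gcongr
    _ = P.eval (n : ℝ) / (Polynomial.X ^ d : Polynomial ℝ).eval (n : ℝ) := by
        rw [hPeval, Polynomial.eval_pow, Polynomial.eval_X, Real.exp_neg, Real.exp_nat_mul,
          Real.exp_log hn']
        ring

end Asymptotics

end SLB

theorem mainTheorem2 (ε : ℝ) (hε : 0 < ε) (m : ℕ → ℕ) (hm : ∀ n, 1 ≤ m n)
    (hmo : (fun n : ℕ => (m n : ℝ)) =o[atTop] (fun n : ℕ => Real.sqrt ((n : ℝ) / Real.log n))) :
    (∀ A : ∀ n, SLB.QueryAlgorithm n (m n), SLB.PolynomialQueries A →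
      ∀ᶠ n in atTop, ∃ f : Fin (m n) → Finset (Fin n) → ℝ,
        SLB.IsInstance f ∧ SLB.IsHomogeneous f ∧
          ¬ SLB.IsApprox ((1 - ε) * (m n : ℝ)) f ((A n).run f)) ∧
    (∀ R : ∀ n, SLB.RandomizedQueryAlgorithm.{u} n (m n), SLB.RandomizedPolynomialQueries R →
      ∀ δ : ℝ, 0 < δ → ∀ᶠ n in atTop, ∃ f : Fin (m n) → Finset (Fin n) → ℝ,
        SLB.IsInstance f ∧ SLB.IsHomogeneous f ∧
          (R n).successProb ((1 - ε) * (m n : ℝ)) f ≤ δ) := by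
  constructor
  · rintro A ⟨p, hp⟩
    filter_upwards [(SLB.tendsto_successBound hε hm hmo p).eventually_lt_const one_pos,
      eventually_gt_atTop 0] with n hn hn0
    obtain ⟨c, hc⟩ := (A n).exists_not_isApprox hε hn0 (hm n)
      (hp n _ (fun _ => SLB.isMonotoneSubmodular_cappedCard n _) fun _ _ => rfl) hn
    exact ⟨_, SLB.isInstance_hardInstance hε c, SLB.isHomogeneous_hardInstance ε c, hc⟩
  · rintro R ⟨p, hp⟩ δ hδ
    filter_upwards [(SLB.tendsto_successBound hε hm hmo p).eventually_lt_const hδ,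
      eventually_gt_atTop 0] with n hn hn0
    obtain ⟨c, hc⟩ := (R n).exists_successProb_le hε hn0 (hm n)
      (hp n _ (fun _ => SLB.isMonotoneSubmodular_cappedCard n _) fun _ _ => rfl)
    exact ⟨_, SLB.isInstance_hardInstance hε c, SLB.isHomogeneous_hardInstance ε c,
      hc.trans hn.le⟩
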